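/- Let $C$ be a field of characteristic zero and $n\ge 1$. Let $\mathcal R=C\{u_2,\dots,u_n\}=C[u_\ell^{(k)} : 2\le \ell\le n,\ k\ge 0]$ be the ring of differential polynomials, with the derivation $\partial$ that vanishes on $C$ and satisfies $\partial(u_\ell^{(k)})=u_\ell^{(k+1)}$. Let $\mathcal R((\partial^{-1}))$ be the ring of formal pseudo-differential operators $\sum_{i\le N}a_i\partial^i$ ($N\in\mathbb Z$, $a_i\in\mathcal R$), with product determined by $\partial^i a=\sum_{m\ge0}\binom{i}{m}\partial^m(a)\,\partial^{i-m}$ for $i\in\mathbb Z$, $a\in\mathcal R$, and let $\mathcal R[\partial]$ be its subring of differential operators ($a_i=0$ for $i<0$). For $A=\sum_i a_i\partial^i$ put $A_+=\sum_{i\ge 0}a_i\partial^i$; the order $\operatorname{ord}A$ is the largest $i$ with $a_i\ne0$ (and $\operatorname{ord}0=-\infty$); $A$ is monic if its leading coefficient is $1$, and in normal form if moreover the coefficient of $\partial^{\operatorname{ord}A-1}$ is $0$. Give $\mathcal R$ the weight with $w(u_\ell^{(k)})=\ell+k$ and $w(c)=0$ for $c\in C\setminus\{0\}$; an operator $P\in\mathcal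 R[\partial]$ is homogeneous of weight $r$ if, for every $i$, the coefficient of $\partial^i$ in $P$ is homogeneous of weight $r-i$ (zero being homogeneous of every weight). Let $L=\partial^n+u_2\partial^{n-2}+\dots+u_{n-1}\partial+u_n$ and let $W(L)=\{A\in\mathcal R[\partial] : \operatorname{ord}(LA-AL)\le n-2\}$, a $C$-vector space. Then there is a unique monic pseudo-differential operator $Q\in\mathcal R((\partial^{-1}))$ of order $1$ with $Q^n=L$. Put $P_j=(Q^j)_+$ for $j\in\mathbb N=\{0,1,2,\dots\}$. Then (1) $(P_j)_{j\in\mathbb N}$ is a $C$-basis of $W(L)$, and each $P_j$ is homogeneous of weight $j$; (2) if $(T_j)_{j\in\mathbb N}$ is any $C$-basis of $W(L)$ such that each $T_j$ is homogeneous of weight $j$, then for every $j$ there is $c_j\in C\setminus\{0\}$ with $T_j=c_jP_j$; (3) each $P_j$ is monic and in normal form. -/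

import Mathlib

/-- Summing over the fibres of a map. -/
theorem finsum_eq_finsum_fiber {α β M : Type*} [AddCommMonoid M] {g : β → M}
    (hg : g.HasFiniteSupport) (h : β → α) (fib : α → Finset β)
    (hfib : ∀ x y, y ∈ fib x ↔ h y = x) :
    ∑ᶠ y, g y = ∑ᶠ x, ∑ y ∈ fib x, g y := by
  classical
  have hg' : (Function.support g).Finite := hg
  have h1 : (Function.support fun x => ∑ y ∈ fib x, g y) ⊆ ↑(hg'.toFinset.image h) := by
    intro x hx
    obtain ⟨y, hy, hy'⟩ := Finset.exists_ne_zero_of_sum_ne_zero hx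
    simp only [Finset.coe_image, Set.mem_image, Finset.mem_coe, Set.Finite.mem_toFinset]
    exact ⟨y, hy', (hfib x y).1 hy⟩
  rw [finsum_eq_sum_of_support_subset _ h1,
    finsum_eq_sum_of_support_subset g (s := hg'.toFinset) (by simp),
    ← Finset.sum_fiberwise_of_maps_to (g := h) (t := hg'.toFinset.image h)
      (fun y hy => Finset.mem_image_of_mem h hy)]
  refine Finset.sum_congr rfl fun x _ => Finset.sum_subset ?_ ?_
  · intro y hy
    exact (hfib x y).2 (Finset.mem_filter.1 hy).2
  · intro y hy hy'
    by_contra hne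
    exact hy' (Finset.mem_filter.2 ⟨by simpa using hne, (hfib x y).1 hy⟩)

/-- Higher Leibniz rule. -/
theorem Derivation.pow_leibniz {C R : Type*} [CommRing C] [CommRing R] [Algebra C R]
    (D : Derivation C R R) (s : ℕ) (a b : R) :
    ((D : R →ₗ[C] R) ^ s) (a * b) = ∑ p ∈ Finset.HasAntidiagonal.antidiagonal s,
      s.choose p.1 • (((D : R →ₗ[C] R) ^ p.1) a * ((D : R →ₗ[C] R) ^ p.2) b) := by
  induction s with
  | zero => simp
  | succ s ih =>
    have key := Finset.sum_antidiagonal_choose_succ_nsmul (M := R)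
      (fun i j => ((D : R →ₗ[C] R) ^ i) a * ((D : R →ₗ[C] R) ^ j) b) s
    rw [key, pow_succ', Module.End.mul_apply, ih, map_sum, ← Finset.sum_add_distrib]
    refine Finset.sum_congr rfl fun p hp => ?_
    have h2 : s.choose p.2 = s.choose p.1 :=
      Nat.choose_symm_of_eq_add (by rw [← Finset.HasAntidiagonal.mem_antidiagonal.1 hp, add_comm])
    rw [map_nsmul, h2, ← smul_add]
    congr 1
    simp only [Derivation.coeFn_coe, Derivation.leibniz, smul_eq_mul, pow_succ',
      Module.End.mul_apply]
    ring

/-- Formal pseudo-differential operators `∑_{i ≤ N} aᵢ ∂ⁱ` (with `N` an integer depending on the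
operator) over a commutative ring `R` with a derivation `D`; `coeff i` is the coefficient `aᵢ`. -/
@[ext]
structure PseudoDiffOp {C R : Type*} [CommRing C] [CommRing R] [Algebra C R]
    (D : Derivation C R R) where
  coeff : ℤ → R
  bddAbove' : ∃ N : ℤ, ∀ i, N < i → coeff i = 0

namespace PseudoDiffOp

variable {C R : Type*} [CommRing C] [CommRing R] [Algebra C R] {D : Derivation C R R}

instance : Zero (PseudoDiffOp D) := ⟨⟨0, 0, fun _ _ => rfl⟩⟩

instance : Add (PseudoDiffOp D) :=
  ⟨fun A B => ⟨A.coeff + B.coeff, by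
    obtain ⟨M, hM⟩ := A.bddAbove'
    obtain ⟨N, hN⟩ := B.bddAbove'
    exact ⟨max M N, fun i hi => by
      simp [hM i (lt_of_le_of_lt (le_max_left _ _) hi),
        hN i (lt_of_le_of_lt (le_max_right _ _) hi)]⟩⟩⟩

instance : Neg (PseudoDiffOp D) :=
  ⟨fun A => ⟨-A.coeff, by
    obtain ⟨M, hM⟩ := A.bddAbove'
    exact ⟨M, fun i hi => by simp [hM i hi]⟩⟩⟩

instance : Sub (PseudoDiffOp D) :=
  ⟨fun A B => ⟨A.coeff - B.coeff, by
    obtain ⟨M, hM⟩ := (A + -B).bddAbove'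
    exact ⟨M, fun i hi => by
      have := hM i hi
      rwa [show (A + -B).coeff i = A.coeff i + -B.coeff i from rfl, ← sub_eq_add_neg] at this⟩⟩⟩

instance {S : Type*} [SMulZeroClass S R] : SMul S (PseudoDiffOp D) :=
  ⟨fun c A => ⟨c • A.coeff, by
    obtain ⟨M, hM⟩ := A.bddAbove'
    exact ⟨M, fun i hi => by simp [hM i hi]⟩⟩⟩

@[simp] theorem coeff_zero (i : ℤ) : (0 : PseudoDiffOp D).coeff i = 0 := rfl

@[simp] theorem coeff_add (A B : PseudoDiffOp D) (i : ℤ) :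
    (A + B).coeff i = A.coeff i + B.coeff i := rfl

@[simp] theorem coeff_neg (A : PseudoDiffOp D) (i : ℤ) : (-A).coeff i = -A.coeff i := rfl

@[simp] theorem coeff_sub (A B : PseudoDiffOp D) (i : ℤ) :
    (A - B).coeff i = A.coeff i - B.coeff i := rfl

@[simp] theorem coeff_smul {S : Type*} [SMulZeroClass S R] (c : S) (A : PseudoDiffOp D) (i : ℤ) :
    (c • A).coeff i = c • A.coeff i := rfl

theorem coeff_injective : Function.Injective (coeff : PseudoDiffOp D → ℤ → R) :=
  fun _ _ h => PseudoDiffOp.ext h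

instance : AddCommGroup (PseudoDiffOp D) :=
  coeff_injective.addCommGroup coeff rfl (fun _ _ => rfl) (fun _ => rfl) (fun _ _ => rfl)
    (fun _ _ => rfl) (fun _ _ => rfl)

/-- The coefficient map as an additive homomorphism. -/
def coeffHom (D : Derivation C R R) : PseudoDiffOp D →+ (ℤ → R) where
  toFun := coeff
  map_zero' := rfl
  map_add' _ _ := rfl

instance : Module C (PseudoDiffOp D) :=
  coeff_injective.module C (coeffHom D) (fun _ _ => rfl)

/-- The monomial `r ∂ⁱ`. -/
def single (D : Derivation C R R) (i : ℤ) (r : R) : PseudoDiffOp D where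
  coeff k := if k = i then r else 0
  bddAbove' := ⟨i, fun _ hk => if_neg hk.ne'⟩

theorem coeff_single (i : ℤ) (r : R) (k : ℤ) :
    (single D i r).coeff k = if k = i then r else 0 := rfl

instance : One (PseudoDiffOp D) := ⟨single D 0 1⟩

theorem coeff_one (k : ℤ) : (1 : PseudoDiffOp D).coeff k = if k = 0 then 1 else 0 := rfl

/-- The contribution of `aᵢ ∂ⁱ` and of the `m`-th term of `∂ⁱ b = ∑ₘ binom(i, m) D^m(b) ∂^{i-m}`
to the coefficient of `∂ᵏ` in a product. -/
noncomputable def mulTerm (A B : PseudoDiffOp D) (k : ℤ) (p : ℤ × ℕ) : R :=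
  Ring.choose p.1 p.2 •
    (A.coeff p.1 * ((D : R →ₗ[C] R) ^ p.2) (B.coeff (k - p.1 + p.2)))

theorem mulTerm_finite (A B : PseudoDiffOp D) (k : ℤ) :
    (mulTerm A B k).HasFiniteSupport := by
  obtain ⟨M, hM⟩ := A.bddAbove'
  obtain ⟨N, hN⟩ := B.bddAbove'
  refine Set.Finite.subset ((Set.finite_Icc (k - N) M).prod
    (Set.finite_Iic (N + M - k).toNat)) ?_
  rintro ⟨i, m⟩ h
  have h1 : i ≤ M := by
    by_contra hc
    exact h (by simp [mulTerm, hM i (by omega)])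
  have h2 : k - i + m ≤ N := by
    by_contra hc
    exact h (by simp [mulTerm, hN (k - i + m) (by omega)])
  simp only [Set.mem_prod, Set.mem_Icc, Set.mem_Iic]
  omega

/-- The product determined by `∂ⁱ b = ∑_{m ≥ 0} binom(i, m) D^m(b) ∂^{i-m}` for all `i : ℤ`. -/
noncomputable instance : Mul (PseudoDiffOp D) :=
  ⟨fun A B => ⟨fun k => ∑ᶠ p : ℤ × ℕ, mulTerm A B k p, by
    obtain ⟨M, hM⟩ := A.bddAbove'
    obtain ⟨N, hN⟩ := B.bddAbove'
    refine ⟨M + N, fun k hk => finsum_eq_zero_of_forall_eq_zero ?_⟩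
    rintro ⟨i, m⟩
    rcases lt_or_ge M i with h | h
    · simp [mulTerm, hM i h]
    · simp [mulTerm, hN (k - i + m) (by omega)]⟩⟩

theorem coeff_mul (A B : PseudoDiffOp D) (k : ℤ) :
    (A * B).coeff k = ∑ᶠ p : ℤ × ℕ, mulTerm A B k p := rfl

theorem one_mul' (A : PseudoDiffOp D) : 1 * A = A := by
  ext k
  rw [coeff_mul, finsum_eq_single _ (0, 0)]
  · simp [mulTerm, coeff_one]
  · rintro ⟨i, m⟩ h
    by_cases hi : i = 0
    · subst hi
      have : 0 < m := Nat.pos_of_ne_zero (by rintro rfl; exact h rfl)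
      simp [mulTerm, Ring.choose_zero_pos ℤ this]
    · simp [mulTerm, coeff_one, hi]

theorem mul_one' (A : PseudoDiffOp D) : A * 1 = A := by
  ext k
  rw [coeff_mul, finsum_eq_single _ (k, 0)]
  · simp [mulTerm, coeff_one]
  · rintro ⟨i, m⟩ h
    rcases m with _ | m
    · have : ¬ k - i = 0 := fun h' => h (by simp; omega)
      simp [mulTerm, coeff_one, this]
    · have : ((D : R →ₗ[C] R) ^ (m + 1)) (if k - i + (m + 1 : ℕ) = 0 then (1 : R) else 0) = 0 := by
        split_ifs
        · simp [pow_succ]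
        · simp
      simp only [mulTerm, coeff_one, this, mul_zero, smul_zero]

theorem mul_add' (A B E : PseudoDiffOp D) : A * (B + E) = A * B + A * E := by
  ext k
  rw [coeff_add, coeff_mul, coeff_mul, coeff_mul,
    ← finsum_add_distrib (mulTerm_finite _ _ _) (mulTerm_finite _ _ _)]
  exact finsum_congr fun p => by simp [mulTerm, mul_add, smul_add]

theorem add_mul' (A B E : PseudoDiffOp D) : (A + B) * E = A * E + B * E := by
  ext k
  rw [coeff_add, coeff_mul, coeff_mul, coeff_mul,
    ← finsum_add_distrib (mulTerm_finite _ _ _) (mulTerm_finite _ _ _)]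
  exact finsum_congr fun p => by simp [mulTerm, add_mul, smul_add]

/-- The general term of a triple product. -/
noncomputable def tripleTerm (A B E : PseudoDiffOp D) (k : ℤ) (z : ℤ × ℤ × ℕ × ℕ × ℕ) : R :=
  (Ring.choose z.1 (z.2.2.1 + z.2.2.2.1) * ((z.2.2.1 + z.2.2.2.1).choose z.2.2.1 : ℤ) *
      Ring.choose z.2.1 z.2.2.2.2) •
    (A.coeff z.1 * ((D : R →ₗ[C] R) ^ z.2.2.1) (B.coeff z.2.1) *
      ((D : R →ₗ[C] R) ^ (z.2.2.2.1 + z.2.2.2.2))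
        (E.coeff (k - z.1 - z.2.1 + z.2.2.1 + z.2.2.2.1 + z.2.2.2.2)))

theorem tripleTerm_finite (A B E : PseudoDiffOp D) (k : ℤ) :
    (tripleTerm A B E k).HasFiniteSupport := by
  obtain ⟨M, hM⟩ := A.bddAbove'
  obtain ⟨N, hN⟩ := B.bddAbove'
  obtain ⟨P, hP⟩ := E.bddAbove'
  have hs := Set.finite_Iic (M + N + P - k).toNat
  refine Set.Finite.subset ((Set.finite_Icc (k - N - P) M).prod
    ((Set.finite_Icc (k - M - P) N).prod (hs.prod (hs.prod hs)))) ?_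
  rintro ⟨i, j, m, r, t⟩ h
  have h1 : i ≤ M := by
    by_contra hc
    exact h (by simp [tripleTerm, hM i (by omega)])
  have h2 : j ≤ N := by
    by_contra hc
    exact h (by simp [tripleTerm, hN j (by omega)])
  have h3 : k - i - j + m + r + t ≤ P := by
    by_contra hc
    exact h (by simp [tripleTerm, hP (k - i - j + m + r + t) (by omega)])
  simp only [Set.mem_prod, Set.mem_Icc, Set.mem_Iic]
  omega

theorem coeff_mul_mul_left (A B E : PseudoDiffOp D) (k : ℤ) :
    ((A * B) * E).coeff k = ∑ᶠ z, tripleTerm A B E k z := by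
  classical
  rw [finsum_eq_finsum_fiber (tripleTerm_finite A B E k)
    (fun z => ((z.1 + z.2.1 - z.2.2.1, z.2.2.2.1 + z.2.2.2.2), (z.1, z.2.2.1)))
    (fun x => (Finset.HasAntidiagonal.antidiagonal x.1.2).image
      fun p => (x.2.1, x.1.1 - x.2.1 + x.2.2, x.2.2, p.1, p.2))]
  swap
  · rintro ⟨⟨q, p⟩, ⟨i', m'⟩⟩ ⟨i, j, m, r, t⟩
    simp only [Finset.mem_image, Finset.HasAntidiagonal.mem_antidiagonal, Prod.mk.injEq, Prod.exists]
    constructor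
    · rintro ⟨r', t', h, rfl, rfl, rfl, rfl, rfl⟩
      refine ⟨⟨by omega, h⟩, rfl, rfl⟩
    · rintro ⟨⟨h1, h2⟩, rfl, rfl⟩
      exact ⟨r, t, h2, rfl, by omega, rfl, rfl, rfl⟩
  have hterm : ∀ x : (ℤ × ℕ) × (ℤ × ℕ),
      ∑ y ∈ (Finset.HasAntidiagonal.antidiagonal x.1.2).image
        (fun p => (x.2.1, x.1.1 - x.2.1 + x.2.2, x.2.2, p.1, p.2)), tripleTerm A B E k y =
      Ring.choose x.1.1 x.1.2 • (mulTerm A B x.1.1 x.2 *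
        ((D : R →ₗ[C] R) ^ x.1.2) (E.coeff (k - x.1.1 + x.1.2))) := by
    rintro ⟨⟨q, p⟩, ⟨i, m⟩⟩
    rw [Finset.sum_image (by rintro ⟨a, b⟩ _ ⟨c, d⟩ _ h; simpa using h)]
    simp only [tripleTerm, mulTerm]
    have hv : Ring.choose q p * Ring.choose i m =
        ∑ y ∈ Finset.HasAntidiagonal.antidiagonal p, Ring.choose i (m + y.1) * ((m + y.1).choose m : ℤ) *
          Ring.choose (q - i + m) y.2 := by
      rw [show q = (i - m) + (q - i + m) by ring, Ring.add_choose_eq _ (Commute.all _ _),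
        Finset.sum_mul]
      refine Finset.sum_congr rfl fun y _ => ?_
      have := Ring.choose_smul_choose i (n := m + y.1) (k := m) (by omega)
      rw [Nat.add_sub_cancel_left, nsmul_eq_mul] at this
      rw [mul_comm (Ring.choose i (m + y.1)), this]
      rw [show i - m + (q - i + m) - i + m = q - i + m by ring]
      ring
    rw [smul_mul_assoc, smul_smul, hv, Finset.sum_smul]
    refine Finset.sum_congr rfl fun y hy => ?_
    rw [← Finset.HasAntidiagonal.mem_antidiagonal.1 hy,
      show k - i - (q - i + m) + m + y.1 + y.2 = k - q + ((y.1 + y.2 : ℕ) : ℤ) by push_cast; ring]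
  simp_rw [hterm]
  rw [coeff_mul]
  refine Eq.trans ?_ (finsum_curry _ ?_).symm
  · refine finsum_congr fun x => ?_
    dsimp only
    rw [mulTerm, coeff_mul, finsum_mul' _ _ (mulTerm_finite _ _ _), smul_finsum' _ ?_]
    exact (mulTerm_finite A B x.1).subset fun y hy => left_ne_zero_of_mul hy
  · obtain ⟨M, hM⟩ := A.bddAbove'
    obtain ⟨N, hN⟩ := B.bddAbove'
    obtain ⟨P, hP⟩ := E.bddAbove'
    have hs := Set.finite_Iic (M + N + P - k).toNat
    refine Set.Finite.subset (((Set.finite_Icc (k - P) (M + N)).prod hs).prod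
      ((Set.finite_Icc (k - P - N) M).prod hs)) ?_
    rintro ⟨⟨q, p⟩, ⟨i, m⟩⟩ h
    have h1 : i ≤ M := by
      by_contra hc
      exact h (by simp [mulTerm, hM i (by omega)])
    have h2 : q - i + m ≤ N := by
      by_contra hc
      exact h (by simp [mulTerm, hN (q - i + m) (by omega)])
    have h3 : k - q + p ≤ P := by
      by_contra hc
      exact h (by simp [hP (k - q + p) (by omega)])
    simp only [Set.mem_prod, Set.mem_Icc, Set.mem_Iic]
    omega

theorem coeff_mul_mul_right (A B E : PseudoDiffOp D) (k : ℤ) :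
    (A * (B * E)).coeff k = ∑ᶠ z, tripleTerm A B E k z := by
  classical
  rw [finsum_eq_finsum_fiber (tripleTerm_finite A B E k)
    (fun z => ((z.1, z.2.2.1 + z.2.2.2.1), (z.2.1, z.2.2.2.2)))
    (fun x => (Finset.HasAntidiagonal.antidiagonal x.1.2).image
      fun p => (x.1.1, x.2.1, p.1, p.2, x.2.2))]
  swap
  · rintro ⟨⟨i', s⟩, ⟨j', t'⟩⟩ ⟨i, j, m, r, t⟩
    simp only [Finset.mem_image, Finset.HasAntidiagonal.mem_antidiagonal, Prod.mk.injEq, Prod.exists]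
    constructor
    · rintro ⟨r', t', h, rfl, rfl, rfl, rfl, rfl⟩
      exact ⟨⟨rfl, h⟩, rfl, rfl⟩
    · rintro ⟨⟨rfl, h2⟩, rfl, rfl⟩
      exact ⟨m, r, h2, rfl, rfl, rfl, rfl, rfl⟩
  have hterm : ∀ x : (ℤ × ℕ) × (ℤ × ℕ),
      ∑ y ∈ (Finset.HasAntidiagonal.antidiagonal x.1.2).image
        (fun p => (x.1.1, x.2.1, p.1, p.2, x.2.2)), tripleTerm A B E k y =
      Ring.choose x.1.1 x.1.2 • (A.coeff x.1.1 *
        ((D : R →ₗ[C] R) ^ x.1.2) (mulTerm B E (k - x.1.1 + x.1.2) x.2)) := by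
    rintro ⟨⟨i, s⟩, ⟨j, t⟩⟩
    rw [Finset.sum_image (by rintro ⟨a, b⟩ _ ⟨c, d⟩ _ h; simpa using h)]
    simp only [tripleTerm, mulTerm]
    rw [map_zsmul, Derivation.pow_leibniz, mul_smul_comm, smul_smul, Finset.mul_sum,
      Finset.smul_sum]
    refine Finset.sum_congr rfl fun y hy => ?_
    have hs := Finset.HasAntidiagonal.mem_antidiagonal.1 hy
    rw [← Module.End.mul_apply, ← pow_add, ← hs, mul_smul_comm, ← natCast_zsmul, smul_smul,
      mul_assoc (A.coeff i)]
    rw [show k - i - j + y.1 + y.2 + t = k - i + ((y.1 + y.2 : ℕ) : ℤ) - j + t by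
      push_cast; ring]
    congr 1
    ring
  simp_rw [hterm]
  rw [coeff_mul]
  refine Eq.trans ?_ (finsum_curry _ ?_).symm
  · refine finsum_congr fun x => ?_
    dsimp only
    have hf := mulTerm_finite B E (k - x.1 + x.2)
    have hf1 : (fun y => ((D : R →ₗ[C] R) ^ x.2)
        (mulTerm B E (k - x.1 + x.2) y)).HasFiniteSupport :=
      Set.Finite.subset hf fun y hy h0 => hy (by simp only [h0, map_zero])
    rw [mulTerm, coeff_mul, map_finsum _ hf, mul_finsum' _ _ hf1, smul_finsum' _ ?_]
    exact Set.Finite.subset hf1 fun y hy => right_ne_zero_of_mul hy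
  · obtain ⟨M, hM⟩ := A.bddAbove'
    obtain ⟨N, hN⟩ := B.bddAbove'
    obtain ⟨P, hP⟩ := E.bddAbove'
    have hs := Set.finite_Iic (M + N + P - k).toNat
    refine Set.Finite.subset (((Set.finite_Icc (k - N - P) M).prod hs).prod
      ((Set.finite_Icc (k - M - P) N).prod hs)) ?_
    rintro ⟨⟨i, s⟩, ⟨j, t⟩⟩ h
    have h1 : i ≤ M := by
      by_contra hc
      exact h (by simp [hM i (by omega)])
    have h2 : j ≤ N := by
      by_contra hc
      exact h (by simp [mulTerm, hN j (by omega)])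
    have h3 : k - i + s - j + t ≤ P := by
      by_contra hc
      exact h (by simp [mulTerm, hP (k - i + s - j + t) (by omega)])
    simp only [Set.mem_prod, Set.mem_Icc, Set.mem_Iic]
    omega

noncomputable instance : Ring (PseudoDiffOp D) where
  __ := (inferInstance : AddCommGroup (PseudoDiffOp D))
  left_distrib := mul_add'
  right_distrib := add_mul'
  zero_mul A := by
    ext k
    rw [coeff_mul]
    exact finsum_eq_zero_of_forall_eq_zero fun p => by simp [mulTerm]
  mul_zero A := by
    ext k
    rw [coeff_mul]
    exact finsum_eq_zero_of_forall_eq_zero fun p => by simp [mulTerm]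
  mul_assoc A B E := by
    ext k
    rw [coeff_mul_mul_left, coeff_mul_mul_right]
  one_mul := one_mul'
  mul_one := mul_one'

noncomputable instance : Algebra C (PseudoDiffOp D) :=
  Algebra.ofModule
    (fun c A B => by
      ext k
      rw [coeff_smul, coeff_mul, coeff_mul, smul_finsum' _ (mulTerm_finite _ _ _)]
      exact finsum_congr fun p => by
        simp only [mulTerm, coeff_smul, smul_mul_assoc, smul_comm c])
    (fun c A B => by
      ext k
      rw [coeff_smul, coeff_mul, coeff_mul, smul_finsum' _ (mulTerm_finite _ _ _)]
      exact finsum_congr fun p => by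
        simp only [mulTerm, coeff_smul, map_smul, mul_smul_comm, smul_comm c])

open Classical in
/-- The order of an operator: the largest `i` whose coefficient is nonzero, and `⊥` (that is,
`-∞`) for the zero operator. -/
noncomputable def ord (A : PseudoDiffOp D) : WithBot ℤ :=
  if A = 0 then ⊥ else ((sSup {i : ℤ | A.coeff i ≠ 0} : ℤ) : WithBot ℤ)

theorem coeff_eq_zero_of_ord_lt {A : PseudoDiffOp D} {i : ℤ} (h : A.ord < i) :
    A.coeff i = 0 := by
  by_contra hc
  have hA : A ≠ 0 := fun h0 => hc (by simp [h0])
  rw [ord, if_neg hA, WithBot.coe_lt_coe] at h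
  obtain ⟨N, hN⟩ := A.bddAbove'
  have hb : BddAbove {i : ℤ | A.coeff i ≠ 0} :=
    ⟨N, fun j hj => by by_contra hlt; exact hj (hN j (by omega))⟩
  exact absurd (le_csSup hb hc) (not_le.2 h)

theorem ord_le_iff {A : PseudoDiffOp D} {m : ℤ} :
    A.ord ≤ m ↔ ∀ i, m < i → A.coeff i = 0 := by
  constructor
  · exact fun h i hi => coeff_eq_zero_of_ord_lt (h.trans_lt (WithBot.coe_lt_coe.2 hi))
  · intro h
    by_cases hA : A = 0
    · simp [ord, hA]
    · rw [ord, if_neg hA, WithBot.coe_le_coe]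
      have hne : {i : ℤ | A.coeff i ≠ 0}.Nonempty := by
        by_contra hc
        refine hA (PseudoDiffOp.ext (funext fun i => ?_))
        by_contra hi
        exact hc ⟨i, hi⟩
      exact csSup_le hne fun i hi => by
        by_contra hlt
        exact hi (h i (by omega))

/-- The leading coefficient (`0` for the zero operator). -/
noncomputable def leadingCoeff (A : PseudoDiffOp D) : R :=
  A.coeff (A.ord.unbotD 0)

def IsMonic (A : PseudoDiffOp D) : Prop :=
  A.leadingCoeff = 1

/-- Normal form: monic, and the coefficient just below the leading one vanishes. -/
def IsNormalForm (A : PseudoDiffOp D) : Prop :=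
  A.IsMonic ∧ A.coeff (A.ord.unbotD 0 - 1) = 0

/-- `A` is a differential operator, i.e. an element of `R[∂] ⊆ R((∂⁻¹))`. -/
def IsDiffOp (A : PseudoDiffOp D) : Prop :=
  ∀ i < 0, A.coeff i = 0

/-- The positive part `A₊ = ∑_{i ≥ 0} aᵢ ∂ⁱ`. -/
def posPart (A : PseudoDiffOp D) : PseudoDiffOp D where
  coeff i := if 0 ≤ i then A.coeff i else 0
  bddAbove' := by
    obtain ⟨N, hN⟩ := A.bddAbove'
    exact ⟨N, fun i hi => by simp [hN i hi]⟩

/-- `Q` is a monic `n`-th root of `L`: a pseudo-differential operator `∂ + q₀ + q₋₁ ∂⁻¹ + ⋯`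
with `Qⁿ = L`. -/
def IsMonicRoot (n : ℕ) (L Q : PseudoDiffOp D) : Prop :=
  Q.ord = 1 ∧ Q.IsMonic ∧ Q ^ n = L

theorem ord_add_two_le_iff {A L : PseudoDiffOp D} :
    A.ord + 2 ≤ L.ord ↔ ∀ i : ℤ, L.ord < i + 2 → A.coeff i = 0 := by
  by_cases hL : L = 0
  · subst hL
    have h0 : (0 : PseudoDiffOp D).ord = ⊥ := by simp [ord]
    rw [h0]
    constructor
    · intro h i _
      refine coeff_eq_zero_of_ord_lt ?_
      have : A.ord = ⊥ := by
        cases hA : A.ord with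
        | bot => rfl
        | coe a => rw [hA] at h; exact absurd h (by exact WithBot.not_coe_le_bot (a + 2))
      rw [this]
      exact WithBot.bot_lt_coe i
    · intro h
      have : A = 0 := PseudoDiffOp.ext (funext fun i => h i (WithBot.bot_lt_coe (i + 2)))
      simp [this, h0]
  · obtain ⟨l, hl⟩ : ∃ l : ℤ, L.ord = l := ⟨_, by rw [ord, if_neg hL]⟩
    rw [hl]
    have h1 : A.ord + 2 ≤ (l : WithBot ℤ) ↔ A.ord ≤ ((l - 2 : ℤ) : WithBot ℤ) := by
      cases A.ord with
      | bot => simp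
      | coe a =>
        rw [show ((a : WithBot ℤ) + 2) = ((a + 2 : ℤ) : WithBot ℤ) from rfl,
          WithBot.coe_le_coe, WithBot.coe_le_coe]
        omega
    rw [h1, ord_le_iff]
    refine forall_congr' fun i => ?_
    rw [show ((i : WithBot ℤ) + 2) = ((i + 2 : ℤ) : WithBot ℤ) from rfl, WithBot.coe_lt_coe]
    exact ⟨fun h hi => h (by omega), fun h hi => h (by omega)⟩

/-- The `C`-vector space `W(L)` of the differential operators `A ∈ R[∂]` that almost commute with
`L`: the order of `[L, A] = L A - A L` is at most `ord L - 2`. -/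
noncomputable def almostCommuting (L : PseudoDiffOp D) : Submodule C (PseudoDiffOp D) where
  carrier := {A | A.IsDiffOp ∧ (L * A - A * L).ord + 2 ≤ L.ord}
  zero_mem' := ⟨fun _ _ => rfl, by
    rw [ord_add_two_le_iff]
    intro i _
    simp⟩
  add_mem' := by
    rintro A B ⟨hA, hA'⟩ ⟨hB, hB'⟩
    refine ⟨fun i hi => by simp [hA i hi, hB i hi], ?_⟩
    rw [ord_add_two_le_iff] at *
    intro i hi
    rw [show L * (A + B) - (A + B) * L = (L * A - A * L) + (L * B - B * L) by noncomm_ring,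
      coeff_add, hA' i hi, hB' i hi, add_zero]
  smul_mem' := by
    rintro c A ⟨hA, hA'⟩
    refine ⟨fun i hi => by simp [hA i hi], ?_⟩
    rw [ord_add_two_le_iff] at *
    intro i hi
    rw [mul_smul_comm, smul_mul_assoc, ← smul_sub, coeff_smul, hA' i hi, smul_zero]

end PseudoDiffOp

/-- The differential variables `u_ℓ^{(k)}`, `2 ≤ ℓ ≤ n`, `k ≥ 0`, as pairs `(ℓ, k)`. -/
abbrev DiffVar (n : ℕ) : Type := Set.Icc 2 n × ℕ

/-- The ring of differential polynomials `C{u₂, …, uₙ}`. -/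
abbrev DiffPoly (n : ℕ) (C : Type*) [CommRing C] : Type _ := MvPolynomial (DiffVar n) C

namespace DiffPoly

variable (n : ℕ) (C : Type*) [CommRing C]

/-- The derivation of `C{u₂, …, uₙ}`: it vanishes on `C` and sends `u_ℓ^{(k)}` to
`u_ℓ^{(k+1)}`. -/
noncomputable def der : Derivation C (DiffPoly n C) (DiffPoly n C) :=
  MvPolynomial.mkDerivation C fun v => MvPolynomial.X (v.1, v.2 + 1)

/-- The weight `w(u_ℓ^{(k)}) = ℓ + k`. -/
def weight (v : DiffVar n) : ℤ := (v.1 : ℕ) + v.2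

variable {n C}

/-- An operator is homogeneous of weight `r` if the coefficient of `∂ⁱ` is homogeneous of weight
`r - i` for every `i`. -/
def IsHomogeneousOp (P : PseudoDiffOp (der n C)) (r : ℤ) : Prop :=
  ∀ i : ℤ, MvPolynomial.IsWeightedHomogeneous (weight n) (P.coeff i) (r - i)

variable (n C)

/-- The formal operator `L = ∂ⁿ + u₂ ∂^{n-2} + ⋯ + u_{n-1} ∂ + uₙ`. -/
noncomputable def formalL : PseudoDiffOp (der n C) :=
  PseudoDiffOp.single _ n 1 +
    ∑ l : Set.Icc 2 n, PseudoDiffOp.single _ ((n : ℤ) - (l : ℕ)) (MvPolynomial.X (l, 0))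

end DiffPoly

/-! Everything is read off from the top two coefficients of a product: the leading one is
multiplicative, and the next has an extra term `a • (A.coeff a * D (B.coeff b))`
(`coeff_mul_sub_one`). Since `R` is commutative, a commutator drops the order by one. Root: if `A`,
`B` are monic of order one, the top coefficient of `A ^ n - B ^ n` is `n` times that of `A - B`
(`coeff_pow_sub_pow`). As `n` is invertible, the coefficients of `Q` are determined one at a time,
which gives existence and uniqueness; each correction has the right weight, so `Q` is homogeneous of
weight 1. Basis: `Q ^ j` commutes with `L = Q ^ n`, so the commutator of `L` with its positive part
is minus that with its tail, of order at most `n - 2`. Conversely, if `A` almost commutes with `L`,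
the top coefficient of the commutator is `n` times the derivative of the leading coefficient of `A`
(`der_coeff_eq_zero`), which is therefore constant (`exists_eq_C_of_der_eq_zero`). Subtracting
multiples of the `P_j` then lowers the order until nothing is left. Uniqueness: a constant has
weight 0, so a nonzero homogeneous member of `W(L)` of weight `r` has order exactly `r`. Two of them
are proportional, because a suitable combination has no term in `∂ʳ`. -/

namespace PseudoDiffOp

/-! ### Filtration by order and top coefficients of products -/

variable {C R : Type*} [CommRing C] [CommRing R] [Algebra C R] {D : Derivation C R R}

/-- The operators of order at most `m`. -/
def filtration (D : Derivation C R R) (m : ℤ) : Submodule C (PseudoDiffOp D) where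
  carrier := {A | ∀ i, m < i → A.coeff i = 0}
  zero_mem' _ _ := rfl
  add_mem' hA hB i hi := by rw [coeff_add, hA i hi, hB i hi, add_zero]
  smul_mem' c A hA i hi := by rw [coeff_smul, hA i hi, smul_zero]

theorem mem_filtration {m : ℤ} {A : PseudoDiffOp D} :
    A ∈ filtration D m ↔ ∀ i, m < i → A.coeff i = 0 := Iff.rfl

theorem filtration_mono {a b : ℤ} (h : a ≤ b) : filtration D a ≤ filtration D b :=
  fun _ hA i hi => hA i (h.trans_lt hi)

theorem mem_filtration_sub_one {m : ℤ} {A : PseudoDiffOp D} (hA : A ∈ filtration D m)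
    (h : A.coeff m = 0) : A ∈ filtration D (m - 1) := by
  intro i hi
  rcases eq_or_lt_of_le (show m ≤ i by omega) with rfl | h'
  · exact h
  · exact hA i h'

theorem ord_eq_of_mem_filtration {m : ℤ} {A : PseudoDiffOp D} (hA : A ∈ filtration D m)
    (h : A.coeff m ≠ 0) : A.ord = m :=
  le_antisymm (ord_le_iff.2 hA) (not_lt.1 fun hlt => h (coeff_eq_zero_of_ord_lt hlt))

/-- The coefficient just below the leading one in a product. -/
theorem coeff_mul_sub_one {a b : ℤ} {A B : PseudoDiffOp D} (hA : A ∈ filtration D a)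
    (hB : B ∈ filtration D b) :
    (A * B).coeff (a + b - 1) =
      A.coeff a * B.coeff (b - 1) + A.coeff (a - 1) * B.coeff b
        + a • (A.coeff a * D (B.coeff b)) := by
  classical
  -- The order bounds `i ≤ a` and `k - i + m ≤ b` leave only three pairs `(i, m)` when `k = a + b -
  -- 1`.
  rw [coeff_mul, finsum_eq_sum_of_support_subset
    (s := {((a, 0) : ℤ × ℕ), (a - 1, 0), (a, 1)})]
  · rw [Finset.sum_insert (by simp; omega), Finset.sum_insert (by simp), Finset.sum_singleton]
    simp only [mulTerm, Ring.choose_zero_right, Ring.choose_one_right, one_smul, pow_zero, pow_one,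
      Module.End.one_apply, Nat.cast_zero, Nat.cast_one, add_zero, Derivation.coeFn_coe, add_assoc]
    rw [show a + b - 1 - a = b - 1 by ring, show a + b - 1 - (a - 1) = b by ring, sub_add_cancel]
  · rintro ⟨i, m⟩ h
    have h1 : i ≤ a := by
      by_contra hc
      exact h (by simp [mulTerm, hA i (by omega)])
    have h2 : a + b - 1 - i + m ≤ b := by
      by_contra hc
      exact h (by simp [mulTerm, hB (a + b - 1 - i + m) (by omega)])
    simp only [Finset.coe_insert, Finset.coe_singleton, Set.mem_insert_iff, Set.mem_singleton_iff,
      Prod.mk.injEq]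
    omega

/-- The leading coefficient of a product. -/
theorem coeff_mul_add {a b : ℤ} {A B : PseudoDiffOp D} (hA : A ∈ filtration D a)
    (hB : B ∈ filtration D b) : (A * B).coeff (a + b) = A.coeff a * B.coeff b := by
  -- With the order bound `b + 1`, the formula for the second coefficient computes the one in degree
  -- `a + b`.
  have h := coeff_mul_sub_one hA (filtration_mono (show b ≤ b + 1 by omega) hB)
  rw [hB (b + 1) (by omega)] at h
  simpa [← add_assoc] using h

theorem mul_mem_filtration {a b : ℤ} {A B : PseudoDiffOp D} (hA : A ∈ filtration D a)
    (hB : B ∈ filtration D b) : A * B ∈ filtration D (a + b) := by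
  intro i hi
  have h := coeff_mul_add (filtration_mono (show a ≤ i - b by omega) hA) hB
  rwa [sub_add_cancel, hA (i - b) (by omega), zero_mul] at h

/-- Commuting lowers the order by one. -/
theorem commutator_mem_filtration {a b : ℤ} {A B : PseudoDiffOp D} (hA : A ∈ filtration D a)
    (hB : B ∈ filtration D b) : A * B - B * A ∈ filtration D (a + b - 1) := by
  refine mem_filtration_sub_one (sub_mem (mul_mem_filtration hA hB)
    (add_comm a b ▸ mul_mem_filtration hB hA)) ?_
  rw [coeff_sub, coeff_mul_add hA hB, add_comm a b, coeff_mul_add hB hA, mul_comm, sub_self]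

theorem one_mem_filtration : (1 : PseudoDiffOp D) ∈ filtration D 0 :=
  fun i hi => by rw [coeff_one, if_neg hi.ne']

theorem single_mem_filtration (i : ℤ) (r : R) : single D i r ∈ filtration D i :=
  fun _ hk => if_neg hk.ne'

/-! ### Powers of monic operators of order one -/

section Pow

variable {A B : PseudoDiffOp D}

theorem pow_mem_filtration (hA : A ∈ filtration D 1) (n : ℕ) : A ^ n ∈ filtration D n := by
  induction n with
  | zero => simpa using one_mem_filtration
  | succ n ih => rw [pow_succ, Nat.cast_succ]; exact mul_mem_filtration ih hA

theorem coeff_pow (hA : A ∈ filtration D 1) (h1 : A.coeff 1 = 1) (n : ℕ) :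
    (A ^ n).coeff n = 1 := by
  induction n with
  | zero => simp [coeff_one]
  | succ n ih =>
    rw [pow_succ, Nat.cast_succ, coeff_mul_add (pow_mem_filtration hA n) hA, ih, h1, one_mul]

/-- The derivative term of the product formula vanishes because leading coefficients are 1. Applied
to the root, this forces its coefficient of `∂⁰` to be 0. -/
theorem coeff_pow_sub_one (hA : A ∈ filtration D 1) (h1 : A.coeff 1 = 1) (n : ℕ) :
    (A ^ n).coeff (n - 1) = n • A.coeff 0 := by
  induction n with
  | zero => simp [coeff_one]
  | succ n ih =>
    rw [pow_succ, Nat.cast_succ, coeff_mul_sub_one (pow_mem_filtration hA n) hA, ih, h1,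
      coeff_pow hA h1, D.map_one_eq_zero]
    simp [add_mul, add_comm]

theorem pow_sub_pow_mem_filtration {e : ℤ} (hA : A ∈ filtration D 1) (hB : B ∈ filtration D 1)
    (h : A - B ∈ filtration D e) (n : ℕ) : A ^ n - B ^ n ∈ filtration D (n - 1 + e) := by
  induction n with
  | zero => simp
  | succ n ih =>
    have : A ^ (n + 1) - B ^ (n + 1) = A ^ n * (A - B) + (A ^ n - B ^ n) * B := by
      rw [pow_succ, pow_succ]; noncomm_ring
    rw [this, Nat.cast_succ, add_sub_cancel_right]
    refine add_mem (mul_mem_filtration (pow_mem_filtration hA n) h) ?_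
    convert mul_mem_filtration ih hB using 2
    ring

/-- The noncommutative telescoping of `A ^ n - B ^ n` has `n` summands, each contributing the top
coefficient of `A - B` since all other factors are monic. This linearisation drives both existence
and uniqueness of the root. -/
theorem coeff_pow_sub_pow {e : ℤ} (hA : A ∈ filtration D 1) (hA1 : A.coeff 1 = 1)
    (hB : B ∈ filtration D 1) (hB1 : B.coeff 1 = 1) (h : A - B ∈ filtration D e) (n : ℕ) :
    (A ^ n - B ^ n).coeff (n - 1 + e) = n • (A - B).coeff e := by
  induction n with
  | zero => simp
  | succ n ih =>
    have : A ^ (n + 1) - B ^ (n + 1) = A ^ n * (A - B) + (A ^ n - B ^ n) * B := by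
      rw [pow_succ, pow_succ]; noncomm_ring
    rw [this, Nat.cast_succ, add_sub_cancel_right, coeff_add,
      coeff_mul_add (pow_mem_filtration hA n) h, coeff_pow hA hA1,
      show (n : ℤ) + e = n - 1 + e + 1 by ring,
      coeff_mul_add (pow_sub_pow_mem_filtration hA hB h n) hB, ih, hB1]
    simp [add_mul, add_comm]

end Pow

/-! ### Uniqueness and existence of the monic root -/

theorem isMonicRoot_iff [Nontrivial R] {n : ℕ} {L Q : PseudoDiffOp D} :
    IsMonicRoot n L Q ↔ Q ∈ filtration D 1 ∧ Q.coeff 1 = 1 ∧ Q ^ n = L := by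
  constructor
  · rintro ⟨h1, h2, h3⟩
    refine ⟨ord_le_iff.1 (by rw [h1]; rfl), ?_, h3⟩
    rwa [IsMonic, leadingCoeff, h1] at h2
  · rintro ⟨h1, h2, h3⟩
    have h : Q.ord = ((1 : ℤ) : WithBot ℤ) := ord_eq_of_mem_filtration h1 (by simp [h2])
    exact ⟨h, by rwa [IsMonic, leadingCoeff, h], h3⟩

theorem eq_zero_of_forall_mem_filtration {A : PseudoDiffOp D} (c : ℤ)
    (h : ∀ m : ℕ, A ∈ filtration D (c - m)) : A = 0 := by
  ext i
  exact h (c - i + 1).toNat i (by omega)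

/-- If `A - B` has order at most `e`, then `n` times its coefficient in degree `e` is a coefficient
of `A ^ n - B ^ n = 0`. The order bound thus drops forever. -/
theorem root_unique [IsAddTorsionFree R] {n : ℕ} (hn : n ≠ 0) {A B : PseudoDiffOp D}
    (hA : A ∈ filtration D 1) (hA1 : A.coeff 1 = 1)
    (hB : B ∈ filtration D 1) (hB1 : B.coeff 1 = 1) (h : A ^ n = B ^ n) : A = B := by
  refine sub_eq_zero.1 (eq_zero_of_forall_mem_filtration 0 fun m => ?_)
  induction m with
  | zero =>
    simpa using mem_filtration_sub_one (sub_mem hA hB) (by rw [coeff_sub, hA1, hB1, sub_self])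
  | succ m ih =>
    have := coeff_pow_sub_pow hA hA1 hB hB1 ih n
    rw [h, sub_self, coeff_zero] at this
    convert mem_filtration_sub_one ih ((smul_eq_zero_iff_right hn).1 this.symm) using 2
    push_cast; ring

section Root

variable {K S : Type*} [Field K] [CommRing S] [Algebra K S] {E : Derivation K S S}

/-- Successive approximations `∂ + q₀ + ⋯ + q_{1-k} ∂^{1-k}` of the `n`-th root of `L`. -/
noncomputable def rootApprox (n : ℕ) (L : PseudoDiffOp E) : ℕ → PseudoDiffOp E
  | 0 => single E 1 1
  | k + 1 => rootApprox n L k +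
      single E (-k) ((n : K)⁻¹ • (L - rootApprox n L k ^ n).coeff (n - 1 - k))

variable {n : ℕ} {L : PseudoDiffOp E}

theorem rootApprox_succ_sub (k : ℕ) :
    rootApprox n L (k + 1) - rootApprox n L k =
      single E (-k) ((n : K)⁻¹ • (L - rootApprox n L k ^ n).coeff (n - 1 - k)) :=
  add_sub_cancel_left _ _

theorem rootApprox_mem_filtration (k : ℕ) : rootApprox n L k ∈ filtration E 1 := by
  induction k with
  | zero => exact single_mem_filtration _ _
  | succ k ih =>
    exact add_mem ih (filtration_mono (by omega) (single_mem_filtration _ _))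

theorem coeff_rootApprox_one (k : ℕ) : (rootApprox n L k).coeff 1 = 1 := by
  induction k with
  | zero => simp [rootApprox, coeff_single]
  | succ k ih =>
    rw [rootApprox, coeff_add, ih, coeff_single, if_neg (by omega), add_zero]

theorem rootApprox_sub_mem_filtration {j k : ℕ} (h : j ≤ k) :
    rootApprox n L k - rootApprox n L j ∈ filtration E (-j) := by
  induction k, h using Nat.le_induction with
  | base => simp
  | succ k hk ih =>
    rw [← sub_add_sub_cancel _ (rootApprox n L k), rootApprox_succ_sub]
    exact add_mem (filtration_mono (by omega) (single_mem_filtration _ _)) ih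

/-- Adding `c ∂⁻ᵏ` changes the top coefficient of the defect by `-n c`, and `c` in `rootApprox` is
chosen to cancel it. -/
theorem sub_rootApprox_pow_mem_filtration [CharZero K] (hn : n ≠ 0) (hL : L ∈ filtration E n)
    (hL1 : L.coeff n = 1) (k : ℕ) : L - rootApprox n L k ^ n ∈ filtration E (n - 1 - k) := by
  induction k with
  | zero =>
    have hf := rootApprox_mem_filtration (n := n) (L := L) 0
    simpa using mem_filtration_sub_one (sub_mem hL (pow_mem_filtration hf n))
      (by rw [coeff_sub, hL1, coeff_pow hf (coeff_rootApprox_one 0), sub_self])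
  | succ k ih =>
    have hs : rootApprox n L (k + 1) - rootApprox n L k ∈ filtration E (-k) := by
      rw [rootApprox_succ_sub]; exact single_mem_filtration _ _
    have h1 := pow_sub_pow_mem_filtration (rootApprox_mem_filtration (k + 1))
      (rootApprox_mem_filtration k) hs n
    have h2 := coeff_pow_sub_pow (rootApprox_mem_filtration (k + 1)) (coeff_rootApprox_one _)
      (rootApprox_mem_filtration k) (coeff_rootApprox_one _) hs n
    rw [← sub_eq_add_neg] at h1 h2
    rw [← sub_sub_sub_cancel_right _ _ (rootApprox n L k ^ n), Nat.cast_succ, ← sub_sub]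
    refine mem_filtration_sub_one (sub_mem ih h1) ?_
    rw [coeff_sub, h2, rootApprox_succ_sub, coeff_single, if_pos rfl, ← Nat.cast_smul_eq_nsmul K,
      smul_smul, mul_inv_cancel₀ (Nat.cast_ne_zero.2 hn), one_smul, sub_self]

/-- The limit of the approximations `rootApprox`. -/
noncomputable def root (n : ℕ) (L : PseudoDiffOp E) : PseudoDiffOp E where
  -- The term in `∂ⁱ` is added in passing to stage `1 - i` and never changes afterwards. For `i > 1`
  -- the stage truncates to 0, where the coefficient is zero.
  coeff i := (rootApprox n L (1 - i).toNat).coeff i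
  bddAbove' := ⟨1, fun i hi => rootApprox_mem_filtration _ i hi⟩

theorem root_sub_rootApprox_mem_filtration (k : ℕ) :
    root n L - rootApprox n L k ∈ filtration E (-k) := by
  intro i hi
  have := rootApprox_sub_mem_filtration (n := n) (L := L) (show (1 - i).toNat ≤ k by omega) i
    (by omega)
  rw [coeff_sub, sub_eq_zero] at this ⊢
  exact this.symm

theorem root_mem_filtration : root n L ∈ filtration E 1 :=
  fun i hi => rootApprox_mem_filtration _ i hi

theorem coeff_root_one : (root n L).coeff 1 = 1 := by
  rw [root, coeff_rootApprox_one]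

theorem root_pow [CharZero K] (hn : n ≠ 0) (hL : L ∈ filtration E n) (hL1 : L.coeff n = 1) :
    root n L ^ n = L := by
  refine sub_eq_zero.1 (eq_zero_of_forall_mem_filtration (n - 1) fun k => ?_)
  rw [← sub_sub_sub_cancel_right _ _ (rootApprox n L k ^ n)]
  exact sub_mem (pow_sub_pow_mem_filtration root_mem_filtration (rootApprox_mem_filtration k)
    (root_sub_rootApprox_mem_filtration k) n) (sub_rootApprox_pow_mem_filtration hn hL hL1 k)

end Root

/-! ### Positive parts and the almost commuting condition -/

section PosPart

theorem coeff_posPart (A : PseudoDiffOp D) (i : ℤ) :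
    A.posPart.coeff i = if 0 ≤ i then A.coeff i else 0 := rfl

theorem posPart_mem_filtration {m : ℤ} {A : PseudoDiffOp D} (hA : A ∈ filtration D m) :
    A.posPart ∈ filtration D m := fun i hi => by
  rw [coeff_posPart, hA i hi, ite_self]

theorem sub_posPart_mem_filtration (A : PseudoDiffOp D) : A - A.posPart ∈ filtration D (-1) :=
  fun i hi => by rw [coeff_sub, coeff_posPart, if_pos (by omega), sub_self]

theorem mem_almostCommuting_iff {n : ℤ} {L A : PseudoDiffOp D} (hL : L.ord = n) :
    A ∈ almostCommuting L ↔ A.IsDiffOp ∧ L * A - A * L ∈ filtration D (n - 2) := by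
  refine and_congr_right fun _ => ?_
  rw [ord_add_two_le_iff, hL, mem_filtration]
  refine forall_congr' fun i => ?_
  rw [show ((i : WithBot ℤ) + 2) = ((i + 2 : ℤ) : WithBot ℤ) from rfl, WithBot.coe_lt_coe,
    sub_lt_iff_lt_add]

/-- The positive part of an operator commuting with `L` almost commutes with `L`. -/
theorem posPart_mem_almostCommuting {n : ℤ} {L A : PseudoDiffOp D} (hL : L.ord = n)
    (h : Commute L A) : A.posPart ∈ almostCommuting L := by
  refine (mem_almostCommuting_iff hL).2 ⟨fun i hi => by rw [coeff_posPart, if_neg hi.not_ge], ?_⟩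
  have hLf : L ∈ filtration D n := ord_le_iff.1 hL.le
  have := neg_mem (commutator_mem_filtration hLf (sub_posPart_mem_filtration A))
  -- The tail `A - A.posPart` has order at most `-1`, so its commutator with `L` has order at most
  -- `n + (-1) - 1 = n - 2`.
  rw [show L * A.posPart - A.posPart * L = -(L * (A - A.posPart) - (A - A.posPart) * L) by
    have := h.eq
    rw [mul_sub, sub_mul, this]; abel]
  convert this using 2
  ring

/-- The leading coefficient of an operator almost commuting with a monic `L` is a constant of the
derivation. -/
theorem der_coeff_eq_zero [IsAddTorsionFree R] {n : ℕ} (hn : n ≠ 0) {L A : PseudoDiffOp D}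
    (hL : L.ord = (n : ℤ)) (hL1 : L.coeff n = 1) {j : ℕ} (hA : A ∈ almostCommuting L)
    (hj : A ∈ filtration D j) : D (A.coeff j) = 0 := by
  have hLf : L ∈ filtration D n := ord_le_iff.1 hL.le
  -- Degree `n + j - 1` exceeds `n - 2`. There every term of the commutator cancels except `n • D
  -- (A.coeff j)`; the opposite term contains `D 1 = 0`.
  have h := ((mem_almostCommuting_iff hL).1 hA).2 (n + j - 1) (by omega)
  rw [coeff_sub, coeff_mul_sub_one hLf hj, add_comm (n : ℤ), coeff_mul_sub_one hj hLf, hL1,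
    D.map_one_eq_zero] at h
  refine (smul_eq_zero_iff_right hn).1 (Eq.trans ?_ h)
  simp only [natCast_zsmul, mul_zero, smul_zero, one_mul]
  ring

end PosPart

end PseudoDiffOp
namespace PseudoDiffOp

variable {C R : Type*} [CommRing C] [CommRing R] [Algebra C R] {D : Derivation C R R}

theorem coeff_sum {ι : Type*} (s : Finset ι) (f : ι → PseudoDiffOp D) (i : ℤ) :
    (∑ l ∈ s, f l).coeff i = ∑ l ∈ s, (f l).coeff i := by
  rw [← Finset.sum_apply]
  exact congrFun (map_sum (coeffHom D) f s) i

/-! ### Triangular families: independence and spanning -/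

section Triangular

variable {K S : Type*} [Field K] [CommRing S] [Algebra K S] {E : Derivation K S S}

/-- Monic operators of pairwise distinct orders are linearly independent. -/
theorem linearIndependent_of_coeff_eq_one [Nontrivial S] {P : ℕ → PseudoDiffOp E}
    (hP : ∀ j : ℕ, P j ∈ filtration E j) (hP1 : ∀ j : ℕ, (P j).coeff j = 1) :
    LinearIndependent K P := by
  rw [linearIndependent_iff]
  intro l hl
  by_contra hne
  obtain ⟨m, hm, hmax⟩ := l.support.exists_max_image id (Finsupp.support_nonempty_iff.2 hne)
  have h := congrArg (fun A => A.coeff m) hl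
  simp only [Finsupp.linearCombination_apply, Finsupp.sum, coeff_sum, coeff_smul,
    coeff_zero] at h
  rw [Finset.sum_eq_single_of_mem m hm fun i hi him => by
    rw [hP i m (by exact_mod_cast lt_of_le_of_ne (hmax i hi) him), smul_zero], hP1,
    ← Algebra.algebraMap_eq_smul_one, map_eq_zero] at h
  exact Finsupp.mem_support_iff.1 hm h

/-- A family of monic members of `W`, one in each order, spans a space `W` of differential
operators whose leading coefficients are constants. -/
theorem mem_span_of_leading_const {W : Submodule K (PseudoDiffOp E)}
    (hd : ∀ A ∈ W, A.IsDiffOp)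
    (hc : ∀ A ∈ W, ∀ j : ℕ, A ∈ filtration E j → ∃ c : K, A.coeff j = algebraMap K S c)
    {P : ℕ → PseudoDiffOp E} (hPW : ∀ j, P j ∈ W)
    (hP : ∀ j : ℕ, P j ∈ filtration E j) (hP1 : ∀ j : ℕ, (P j).coeff j = 1)
    {A : PseudoDiffOp E} (hA : A ∈ W) : A ∈ Submodule.span K (Set.range P) := by
  -- The shift by one makes the base case a differential operator of negative order, which is zero.
  have key : ∀ m : ℕ, ∀ A ∈ W, A ∈ filtration E (m - 1) → A ∈ Submodule.span K (Set.range P) := by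
    intro m
    induction m with
    | zero =>
      intro A hA hf
      have : A = 0 := by
        ext i
        rcases lt_or_ge i 0 with h | h
        · exact hd A hA i h
        · exact hf i (by simpa using by omega)
      rw [this]
      exact zero_mem _
    | succ m ih =>
      intro A hA hf
      rw [Nat.cast_succ, add_sub_cancel_right] at hf
      obtain ⟨c, hcA⟩ := hc A hA m hf
      rw [← sub_add_cancel A (c • P m)]
      refine add_mem (ih _ (sub_mem hA (W.smul_mem c (hPW m))) (mem_filtration_sub_one
        (sub_mem hf (Submodule.smul_mem _ c (hP m))) ?_))
        (Submodule.smul_mem _ c (Submodule.subset_span ⟨m, rfl⟩))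
      rw [coeff_sub, coeff_smul, hP1, hcA, Algebra.algebraMap_eq_smul_one, sub_self]
  obtain ⟨N, hN⟩ := A.bddAbove'
  exact key (N + 1).toNat A hA fun i hi => hN i (by omega)

end Triangular

end PseudoDiffOp

/-! ### Constants of the derivation -/

namespace DiffPoly

open MvPolynomial PseudoDiffOp

variable {n : ℕ} {C : Type*}

section CommRing

variable [CommRing C]

theorem der_X (v : DiffVar n) : der n C (X v) = X (v.1, v.2 + 1) := mkDerivation_X _ _ _

/-- Both sides are derivations, so it suffices to compare them on variables. -/
theorem lie_pderiv_der (l : Set.Icc 2 n) (k : ℕ) :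
    ⁅(pderiv (l, k + 1) : Derivation C (DiffPoly n C) (DiffPoly n C)), der n C⁆ =
      pderiv (l, k) := by
  classical
  ext1 v
  rw [Derivation.commutator_apply, der_X, pderiv_X, pderiv_X, pderiv_X]
  obtain ⟨l', k'⟩ := v
  by_cases h : (l', k') = (l, k)
  · obtain ⟨rfl, rfl⟩ := Prod.mk.inj h
    simp
  · have h' : ¬ (l', k' + 1) = (l, k + 1) := by simpa using h
    rw [Pi.single_eq_of_ne h', Pi.single_eq_of_ne h, Pi.single_apply]
    split_ifs <;> simp

/-- By the commutator relation, a nonzero partial derivative in `u_ℓ^{(k)}` forces a nonzero one in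
`u_ℓ^{(k+1)}`, and so on without end; but `f` involves finitely many variables. -/
theorem pderiv_eq_zero_of_der_eq_zero {f : DiffPoly n C} (hf : der n C f = 0) (v : DiffVar n) :
    pderiv v f = 0 := by
  classical
  obtain ⟨l, k⟩ := v
  have step : ∀ k, pderiv (l, k + 1) f = 0 → pderiv (l, k) f = 0 := fun k h => by
    rw [← lie_pderiv_der, Derivation.commutator_apply, hf, h, map_zero, map_zero, sub_zero]
  by_contra hk
  have hall : ∀ m, pderiv (l, k + m) f ≠ 0 := fun m => by
    induction m with
    | zero => exact hk
    | succ m ih => exact fun h => ih (step _ h)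
  have hm : k + (f.vars.sup Prod.snd + 1) ≤ f.vars.sup Prod.snd :=
    Finset.le_sup (f := Prod.snd)
      (by_contra fun h => hall _ (pderiv_eq_zero_of_notMem_vars (i := (l, _)) h))
  omega

/-- The constants of the differential polynomials are the coefficients. -/
theorem exists_eq_C_of_der_eq_zero [IsDomain C] [CharZero C] {f : DiffPoly n C}
    (hf : der n C f = 0) : ∃ c, f = MvPolynomial.C c := by
  classical
  refine ⟨f.coeff 0, MvPolynomial.ext _ _ fun s => ?_⟩
  rw [coeff_C]
  split_ifs with hs
  · rw [hs]
  · obtain ⟨v, hv⟩ := Finsupp.ne_iff.1 (Ne.symm hs)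
    have h := coeff_pderiv (i := v) f (s - Finsupp.single v 1)
    rw [pderiv_eq_zero_of_der_eq_zero hf, MvPolynomial.coeff_zero, Finsupp.sub_add_single_one_cancel hv] at h
    exact (mul_eq_zero.1 h.symm).resolve_right (Nat.cast_add_one_ne_zero _)

/-! ### Weights of operators -/

theorem isWeightedHomogeneous_der {f : DiffPoly n C} {r : ℤ}
    (hf : IsWeightedHomogeneous (weight n) f r) :
    IsWeightedHomogeneous (weight n) (der n C f) (r + 1) := by
  induction hf using IsWeightedHomogeneous.induction_on with
  | zero => rw [map_zero]; exact isWeightedHomogeneous_zero _ _ _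
  | add p q _ _ hp hq => rw [map_add]; exact hp.add hq
  | monomial d c hd =>
    rw [der, mkDerivation_monomial, smul_eq_C_mul]
    refine IsWeightedHomogeneous.C_mul (IsWeightedHomogeneous.sum _ _ _ fun v hv => ?_) _
    have h1 := isWeightedHomogeneous_monomial (weight n) (d - Finsupp.single v 1) (d v : C)
      (m := r - weight n v) (by
        rw [eq_sub_iff_add_eq, ← hd]
        exact Finsupp.weight_sub_single_add (Finsupp.mem_support_iff.1 hv))
    have h2 : weight n (v.1, v.2 + 1) = weight n v + 1 := by simp [weight, add_assoc]
    have h3 := h1.mul (isWeightedHomogeneous_X C (weight n) (v.1, v.2 + 1))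
    rwa [h2, ← add_assoc, sub_add_cancel] at h3

theorem isWeightedHomogeneous_der_pow {f : DiffPoly n C} {r : ℤ}
    (hf : IsWeightedHomogeneous (weight n) f r) (m : ℕ) :
    IsWeightedHomogeneous (weight n)
      (((der n C : DiffPoly n C →ₗ[C] DiffPoly n C) ^ m) f) (r + m) := by
  induction m with
  | zero => simpa using hf
  | succ m ih =>
    rw [pow_succ', Module.End.mul_apply, Nat.cast_succ, ← add_assoc]
    exact isWeightedHomogeneous_der ih

variable {A B : PseudoDiffOp (der n C)} {r s : ℤ}

theorem IsHomogeneousOp.add (hA : IsHomogeneousOp A r) (hB : IsHomogeneousOp B r) :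
    IsHomogeneousOp (A + B) r := fun i => (hA i).add (hB i)

theorem IsHomogeneousOp.sub (hA : IsHomogeneousOp A r) (hB : IsHomogeneousOp B r) :
    IsHomogeneousOp (A - B) r := fun i => (hA i).sub (hB i)

theorem isWeightedHomogeneous_smul {S : Type*} [SMulZeroClass S C] {f : DiffPoly n C}
    (hf : IsWeightedHomogeneous (weight n) f r) (c : S) :
    IsWeightedHomogeneous (weight n) (c • f) r := fun d hd => hf fun h => hd (by
  rw [MvPolynomial.coeff_smul, h, smul_zero])

theorem IsHomogeneousOp.smul (hA : IsHomogeneousOp A r) (c : C) :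
    IsHomogeneousOp (c • A) r := fun i => isWeightedHomogeneous_smul (hA i) c

/-- In each term, `m` derivatives raise the weight by `m`, offsetting the shift of the index of `B`
by `m`: the weight is `(r - i) + (s - (k - i + m)) + m = r + s - k`. -/
theorem IsHomogeneousOp.mul (hA : IsHomogeneousOp A r) (hB : IsHomogeneousOp B s) :
    IsHomogeneousOp (A * B) (r + s) := by
  intro k
  rw [PseudoDiffOp.coeff_mul, finsum_eq_sum _ (mulTerm_finite A B k)]
  refine IsWeightedHomogeneous.sum _ _ _ fun p _ => ?_
  refine isWeightedHomogeneous_smul ?_ (Ring.choose p.1 p.2)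
  convert (hA p.1).mul (isWeightedHomogeneous_der_pow (hB (k - p.1 + p.2)) p.2) using 1
  ring

theorem isHomogeneousOp_single {f : DiffPoly n C} {i : ℤ}
    (hf : IsWeightedHomogeneous (weight n) f (r - i)) :
    IsHomogeneousOp (single (der n C) i f) r := by
  intro k
  rw [coeff_single]
  split_ifs with h
  · rwa [h]
  · exact isWeightedHomogeneous_zero _ _ _

theorem IsHomogeneousOp.pow (hA : IsHomogeneousOp A r) (m : ℕ) :
    IsHomogeneousOp (A ^ m) (m * r) := by
  induction m with
  | zero => exact isHomogeneousOp_single (by simpa using isWeightedHomogeneous_one C (weight n))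
  | succ m ih => rw [pow_succ, Nat.cast_succ, add_one_mul]; exact ih.mul hA

theorem IsHomogeneousOp.posPart (hA : IsHomogeneousOp A r) : IsHomogeneousOp A.posPart r := by
  intro i
  rw [coeff_posPart]
  split_ifs
  · exact hA i
  · exact isWeightedHomogeneous_zero _ _ _

theorem isHomogeneousOp_sum {ι : Type*} (t : Finset ι) {F : ι → PseudoDiffOp (der n C)}
    (hF : ∀ l ∈ t, IsHomogeneousOp (F l) r) : IsHomogeneousOp (∑ l ∈ t, F l) r :=
  Finset.sum_induction F (IsHomogeneousOp · r) (fun _ _ => IsHomogeneousOp.add)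
    (fun _ => isWeightedHomogeneous_zero _ _ _) hF

variable (n C)

theorem isHomogeneousOp_formalL : IsHomogeneousOp (formalL n C) n := by
  refine IsHomogeneousOp.add (isHomogeneousOp_single ?_) (isHomogeneousOp_sum _ fun l _ =>
    isHomogeneousOp_single ?_)
  · simpa using isWeightedHomogeneous_one C (weight n)
  · convert isWeightedHomogeneous_X C (weight n) (l, 0) using 1
    simp [weight]

theorem coeff_formalL {i : ℤ} (hi : (n : ℤ) - 1 ≤ i) :
    (formalL n C).coeff i = if i = n then 1 else 0 := by
  rw [formalL, PseudoDiffOp.coeff_add, PseudoDiffOp.coeff_sum, Finset.sum_eq_zero,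
    add_zero, coeff_single]
  rintro ⟨l, hl⟩ -
  exact if_neg (by have := hl.1; simp only; omega)

end CommRing

end DiffPoly
-- Weight of the root
namespace PseudoDiffOp

variable {K S : Type*} [Field K] [CommRing S] [Algebra K S] {E : Derivation K S S}

theorem coeff_root (n : ℕ) (L : PseudoDiffOp E) (i : ℤ) :
    (root n L).coeff i = (rootApprox n L (1 - i).toNat).coeff i := by
  rw [root]

end PseudoDiffOp

namespace DiffPoly

open MvPolynomial PseudoDiffOp

section Field

variable {n : ℕ} {C : Type*} [Field C]

theorem isHomogeneousOp_rootApprox {L : PseudoDiffOp (der n C)} (hL : IsHomogeneousOp L n)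
    (k : ℕ) : IsHomogeneousOp (rootApprox n L k) 1 := by
  induction k with
  | zero => exact isHomogeneousOp_single (by simpa using isWeightedHomogeneous_one C (weight n))
  | succ k ih =>
    refine ih.add (isHomogeneousOp_single (isWeightedHomogeneous_smul ?_ _))
    -- The defect has weight `n`, so its coefficient in degree `n - 1 - k` has weight `1 + k`, as
    -- required at `∂⁻ᵏ`.
    have hp := ih.pow n
    rw [mul_one] at hp
    convert (hL.sub hp) (n - 1 - k) using 1
    ring

theorem isHomogeneousOp_root {L : PseudoDiffOp (der n C)} (hL : IsHomogeneousOp L n) :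
    IsHomogeneousOp (root n L) 1 := fun i => by
  rw [coeff_root]
  exact isHomogeneousOp_rootApprox hL _ i

variable (n C)

theorem ord_formalL : (formalL n C).ord = (n : ℤ) :=
  ord_eq_of_mem_filtration (fun i hi => by rw [coeff_formalL n C (by omega), if_neg hi.ne'])
    (by rw [coeff_formalL n C (by omega), if_pos rfl]; exact one_ne_zero)

theorem coeff_formalL_self : (formalL n C).coeff n = 1 := by
  rw [coeff_formalL n C (by omega), if_pos rfl]

/-! ### Homogeneous members of `W(L)` -/

variable {n C} [CharZero C]

theorem exists_coeff_eq_of_mem_almostCommuting (hn : n ≠ 0) {A : PseudoDiffOp (der n C)}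
    (hA : A ∈ almostCommuting (formalL n C)) {j : ℕ} (hj : A ∈ filtration (der n C) j) :
    ∃ c : C, A.coeff j = MvPolynomial.C c :=
  exists_eq_C_of_der_eq_zero
    (der_coeff_eq_zero hn (ord_formalL n C) (coeff_formalL_self n C) hA hj)

/-- The top coefficient is a constant, of weight 0, while homogeneity gives it weight `r - j ≠ 0`.
-/
theorem coeff_eq_zero_of_homogeneous (hn : n ≠ 0) {A : PseudoDiffOp (der n C)}
    (hA : A ∈ almostCommuting (formalL n C)) {r : ℕ} (hr : IsHomogeneousOp A r) {j : ℕ}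
    (hj : A ∈ filtration (der n C) j) (h : j ≠ r) : A.coeff j = 0 := by
  obtain ⟨c, hc⟩ := exists_coeff_eq_of_mem_almostCommuting hn hA hj
  by_contra hne
  have h1 := hr j
  rw [hc] at h1 hne
  have := IsWeightedHomogeneous.inj_right hne h1 (isWeightedHomogeneous_C (weight n) c)
  omega

/-- An operator of weight `r` almost commuting with `L` has order at most `r`. -/
theorem mem_filtration_of_homogeneous (hn : n ≠ 0) {A : PseudoDiffOp (der n C)}
    (hA : A ∈ almostCommuting (formalL n C)) {r : ℕ} (hr : IsHomogeneousOp A r) :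
    A ∈ filtration (der n C) r := by
  have key : ∀ m : ℕ, A ∈ filtration (der n C) (r + m : ℕ) → A ∈ filtration (der n C) r := by
    intro m
    induction m with
    | zero => exact id
    | succ m ih =>
      intro hf
      refine ih ?_
      convert mem_filtration_sub_one hf (coeff_eq_zero_of_homogeneous hn hA hr hf (by omega))
        using 2
      push_cast
      ring
  obtain ⟨N, hN⟩ := A.bddAbove'
  exact key N.toNat fun i hi => hN i (by omega)

/-- An operator of weight `r` almost commuting with `L` vanishes if its coefficient of `∂ʳ`
does. -/
theorem eq_zero_of_homogeneous (hn : n ≠ 0) {A : PseudoDiffOp (der n C)}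
    (hA : A ∈ almostCommuting (formalL n C)) {r : ℕ} (hr : IsHomogeneousOp A r)
    (h0 : A.coeff r = 0) : A = 0 := by
  have key : ∀ m : ℕ, A ∈ filtration (der n C) (m - 1) → A = 0 := by
    intro m
    induction m with
    | zero =>
      intro hf
      ext1
      funext i
      rcases lt_or_ge i 0 with h | h
      · exact hA.1 i h
      · exact hf i (by simpa using by omega)
    | succ m ih =>
      intro hf
      rw [Nat.cast_succ, add_sub_cancel_right] at hf
      refine ih (mem_filtration_sub_one hf ?_)
      by_cases hm : m = r
      · rwa [hm]
      · exact coeff_eq_zero_of_homogeneous hn hA hr hf hm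
  refine key (r + 1) ?_
  rw [Nat.cast_succ, add_sub_cancel_right]
  exact mem_filtration_of_homogeneous hn hA hr

/-- An operator of weight `r` almost commuting with `L` is a multiple of any monic one. -/
theorem exists_eq_smul_of_homogeneous (hn : n ≠ 0) {A P : PseudoDiffOp (der n C)}
    (hA : A ∈ almostCommuting (formalL n C)) (hP : P ∈ almostCommuting (formalL n C)) {r : ℕ}
    (hAr : IsHomogeneousOp A r) (hPr : IsHomogeneousOp P r) (hP1 : P.coeff r = 1) :
    ∃ c : C, A = c • P := by
  obtain ⟨c, hc⟩ := exists_coeff_eq_of_mem_almostCommuting hn hA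
    (mem_filtration_of_homogeneous hn hA hAr)
  refine ⟨c, sub_eq_zero.1 (eq_zero_of_homogeneous hn
    (sub_mem hA (Submodule.smul_mem _ c hP)) (hAr.sub (hPr.smul c)) ?_)⟩
  rw [PseudoDiffOp.coeff_sub, PseudoDiffOp.coeff_smul, hc, hP1, smul_eq_C_mul, mul_one, sub_self]

end Field

end DiffPoly

/-! ### The main theorem -/

open PseudoDiffOp DiffPoly in
theorem mainTheorem3 {C : Type*} [Field C] [CharZero C] (n : ℕ) (hn : 1 ≤ n) :
    (∃! Q, PseudoDiffOp.IsMonicRoot n (DiffPoly.formalL n C) Q) ∧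
    ∀ Q, PseudoDiffOp.IsMonicRoot n (DiffPoly.formalL n C) Q →
      (∃ b : Module.Basis ℕ C (PseudoDiffOp.almostCommuting (DiffPoly.formalL n C)),
        ∀ j, (b j : PseudoDiffOp (DiffPoly.der n C)) = (Q ^ j).posPart) ∧
      (∀ j : ℕ, DiffPoly.IsHomogeneousOp (Q ^ j).posPart j) ∧
      (∀ T : Module.Basis ℕ C (PseudoDiffOp.almostCommuting (DiffPoly.formalL n C)),
        (∀ j : ℕ, DiffPoly.IsHomogeneousOp
          (T j : PseudoDiffOp (DiffPoly.der n C)) j) →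
        ∃ c : ℕ → Cˣ, ∀ j,
          (T j : PseudoDiffOp (DiffPoly.der n C)) = (c j : C) • (Q ^ j).posPart) ∧
      (∀ j : ℕ, (Q ^ j).posPart.IsMonic ∧ (Q ^ j).posPart.IsNormalForm) := by
  have hn0 : n ≠ 0 := by omega
  have hLf : formalL n C ∈ filtration (der n C) n := ord_le_iff.1 (ord_formalL n C).le
  have hL1 := coeff_formalL_self n C
  have huniq : ∀ Q, IsMonicRoot n (formalL n C) Q → Q = root n (formalL n C) := by
    intro Q hQ
    obtain ⟨h1, h2, h3⟩ := isMonicRoot_iff.1 hQ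
    exact root_unique hn0 h1 h2 root_mem_filtration coeff_root_one
      (h3.trans (root_pow hn0 hLf hL1).symm)
  refine ⟨⟨root n (formalL n C), isMonicRoot_iff.2
    ⟨root_mem_filtration, coeff_root_one, root_pow hn0 hLf hL1⟩, huniq⟩, fun Q hQ => ?_⟩
  have hhom : IsHomogeneousOp Q 1 := by
    rw [huniq Q hQ]
    exact isHomogeneousOp_root (isHomogeneousOp_formalL n C)
  obtain ⟨hQf, hQ1, hQn⟩ := isMonicRoot_iff.1 hQ
  have hPW : ∀ j : ℕ, (Q ^ j).posPart ∈ almostCommuting (formalL n C) := fun j =>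
    posPart_mem_almostCommuting (ord_formalL n C) (hQn ▸ Commute.pow_pow_self Q n j)
  have hPf : ∀ j : ℕ, (Q ^ j).posPart ∈ filtration (der n C) j := fun j =>
    posPart_mem_filtration (pow_mem_filtration hQf j)
  have hP1 : ∀ j : ℕ, (Q ^ j).posPart.coeff j = 1 := fun j => by
    rw [coeff_posPart, if_pos (by omega), coeff_pow hQf hQ1]
  have hPh : ∀ j : ℕ, IsHomogeneousOp (Q ^ j).posPart j := fun j => by
    simpa using (hhom.pow j).posPart
  have hord : ∀ j : ℕ, (Q ^ j).posPart.ord = (j : ℤ) := fun j =>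
    ord_eq_of_mem_filtration (hPf j) (by rw [hP1]; exact one_ne_zero)
  have hmonic : ∀ j : ℕ, (Q ^ j).posPart.IsMonic := fun j => by
    rw [IsMonic, leadingCoeff, hord]
    exact hP1 j
  -- The coefficient of `∂ⁿ⁻¹` in `Qⁿ = L` is both `n • Q.coeff 0` and 0.
  have hQ0 : Q.coeff 0 = 0 := by
    have h := coeff_pow_sub_one hQf hQ1 n
    rw [hQn, coeff_formalL n C le_rfl, if_neg (by omega)] at h
    exact (smul_eq_zero_iff_right hn0).1 h.symm
  refine ⟨?_, hPh, fun T hT => ?_, fun j => ⟨hmonic j, hmonic j, ?_⟩⟩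
  · have hli : LinearIndependent C fun j : ℕ =>
        (⟨(Q ^ j).posPart, hPW j⟩ : almostCommuting (formalL n C)) :=
      LinearIndependent.of_comp (almostCommuting (formalL n C)).subtype
        (linearIndependent_of_coeff_eq_one hPf hP1)
    refine ⟨Module.Basis.mk hli ?_, fun j => by rw [Module.Basis.mk_apply]⟩
    rintro ⟨A, hA⟩ -
    have h := mem_span_of_leading_const (W := almostCommuting (formalL n C)) (fun A hA => hA.1)
      (fun A hA j hj => exists_coeff_eq_of_mem_almostCommuting hn0 hA hj) hPW hPf hP1 hA
    -- The spanning statement lives in the ambient space; the inclusion of `W(L)` carries it back to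
    -- the subspace.
    have hr : Set.range (fun j : ℕ => (Q ^ j).posPart) =
        (almostCommuting (formalL n C)).subtype '' Set.range fun j : ℕ =>
          (⟨(Q ^ j).posPart, hPW j⟩ : almostCommuting (formalL n C)) := by
      rw [← Set.range_comp]
      rfl
    rw [hr, Submodule.span_image] at h
    obtain ⟨B, hB, hBA⟩ := h
    rwa [show B = ⟨A, hA⟩ from Subtype.ext hBA] at hB
  · have h : ∀ j, ∃ c : Cˣ, (T j : PseudoDiffOp (der n C)) = (c : C) • (Q ^ j).posPart := by
      intro j
      obtain ⟨c, hc⟩ := exists_eq_smul_of_homogeneous hn0 (T j).2 (hPW j) (hT j) (hPh j) (hP1 j)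
      have hc0 : c ≠ 0 := by
        rintro rfl
        rw [zero_smul] at hc
        exact T.ne_zero j (Subtype.ext hc)
      exact ⟨Units.mk0 c hc0, hc⟩
    choose c hc using h
    exact ⟨c, hc⟩
  · rw [hord]
    change (Q ^ j).posPart.coeff ((j : ℤ) - 1) = 0
    -- For `j = 0` the degree is `-1` and the positive part cuts it off; otherwise the coefficient
    -- is `j • Q.coeff 0 = 0`.
    rw [coeff_posPart, coeff_pow_sub_one hQf hQ1, hQ0, smul_zero, ite_self]
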